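/- Let $d\ge 1$ and let $\Sigma$ be a finite alphabet. For $1\le i\le d$ let $(p_{t,i})_{t\ge 0}$ be positive integers with $p_{0,i}\ge 2$ and $p_{t,i}\mid p_{t+1,i}$. Put $p_t\mathbb Z^d=\prod_i p_{t,i}\mathbb Z$. For each $t\ge 0$ let $A_t$ be a block of size $p_{t,1}\times\cdots\times p_{t,d}$, each of whose cells is either filled with a symbol of $\Sigma$ or left unfilled (a hole), such that $A_{t+1}$ is the concatenation of $p_{t+1,i}/p_{t,i}$ copies of $A_t$ along the $i$-th dimension $(1\le i\le d)$ with some (possibly none or all) of the holes filled by symbols of $\Sigma$. The copies of $A_t$ so placed in $A_{t+1}$ are called the $t$-blocks of $A_{t+1}$. Let $\omega\in\Sigma^{\mathbb Z^d}$ be the Toeplitz array obtained from these blocks: there are $c_t\in\mathbb Z^d$ with $c_{t+1}-c_t\in p_t\mathbb Z^d$ such that, for every $t$, when $\mathbb Z^d$ is tiled by copies of $A_t$ with corners at the points of $c_t+p_t\mathbb Z^d$, the array $\omega$ agrees with each copy at all its filled cells; every position of $\mathbb Z^d$ lies in a filled cell of this tiling for some $t$; and the holes of $A_t$ are genuine,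 that is, for each hole of $A_t$ there are two tiles of the $t$-th tiling at whose corresponding cells $\omega$ takes different values. Suppose that condition $(*)$ holds: for every $t\ge 0$, 1. every $t$-block of $A_{t+1}$ is either $A_t$ itself or $A_t$ with all of its holes filled (different blocks may be filled differently); 2. every $t$-block of $A_{t+1}$ on the perimeter of $A_{t+1}$ (i.e. which is first or last in at least one of the $d$ directions) has all of its holes filled. Let $T$ be the shift action of $\mathbb Z^d$, $(T^g x)(v)=x(v+g)$, and let $\overline{O(\omega)}$ be the closure of $\{T^g\omega: g\in\mathbb Z^d\}$ in the product topology. Then the centralizer of $(\overline{O(\omega)},T)$ is trivial: every homeomorphism $S$ of $\overline{O(\omega)}$ with $S T^g=T^g S$ for all $g\in\mathbb Z^d$ equals $T^h$ for some $h\in\mathbb Z^d$. -/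

import Mathlib

namespace ZdToeplitz

/-- The shift `T^g` on arrays: `(T^g x)(v) = x (v + g)`. -/
def shift {d : ℕ} {α : Type*} (g : Fin d → ℤ) (x : (Fin d → ℤ) → α) : (Fin d → ℤ) → α :=
  fun v => x (v + g)

/-- The closure of the shift orbit of `x` in the product topology. -/
def orbitClosure {d : ℕ} {α : Type*} [TopologicalSpace α] (x : (Fin d → ℤ) → α) :
    Set ((Fin d → ℤ) → α) :=
  closure (Set.range fun g => shift g x)

theorem continuous_shift {d : ℕ} {α : Type*} [TopologicalSpace α] (g : Fin d → ℤ) :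
    Continuous (shift g : ((Fin d → ℤ) → α) → ((Fin d → ℤ) → α)) :=
  continuous_pi fun v => continuous_apply (v + g)

theorem shift_shift {d : ℕ} {α : Type*} (g h : Fin d → ℤ) (x : (Fin d → ℤ) → α) :
    shift g (shift h x) = shift (g + h) x := by
  funext v
  simp [shift, add_assoc]

theorem shift_zero {d : ℕ} {α : Type*} (x : (Fin d → ℤ) → α) : shift 0 x = x := by
  funext v
  simp [shift]

theorem shift_mem_orbitClosure {d : ℕ} {α : Type*} [TopologicalSpace α]
    (x : (Fin d → ℤ) → α) (g : Fin d → ℤ) {y : (Fin d → ℤ) → α} (hy : y ∈ orbitClosure x) :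
    shift g y ∈ orbitClosure x := by
  refine map_mem_closure (continuous_shift g) hy ?_
  rintro _ ⟨h, rfl⟩
  exact ⟨g + h, (shift_shift g h x).symm⟩

/-- The shift `T^g` as a homeomorphism of the orbit closure of `x`. -/
def shiftHomeo {d : ℕ} {α : Type*} [TopologicalSpace α] (x : (Fin d → ℤ) → α)
    (g : Fin d → ℤ) : orbitClosure x ≃ₜ orbitClosure x where
  toFun y := ⟨shift g y, shift_mem_orbitClosure x g y.2⟩
  invFun y := ⟨shift (-g) y, shift_mem_orbitClosure x (-g) y.2⟩
  left_inv y := by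
    apply Subtype.ext
    simp [shift_shift, shift_zero]
  right_inv y := by
    apply Subtype.ext
    simp [shift_shift, shift_zero]
  continuous_toFun := ((continuous_shift g).comp continuous_subtype_val).subtype_mk _
  continuous_invFun := ((continuous_shift (-g)).comp continuous_subtype_val).subtype_mk _

/-- The centralizer of the orbit closure of `x`: all its homeomorphisms which commute with every
shift `T^g`. -/
def shiftCentralizer {d : ℕ} {α : Type*} [TopologicalSpace α] (x : (Fin d → ℤ) → α) :
    Subgroup (orbitClosure x ≃ₜ orbitClosure x) :=
  Subgroup.centralizer (Set.range (shiftHomeo x))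

/-- The centralizer is trivial: each of its elements is a shift `T^h`. -/
def HasTrivialCentralizer {d : ℕ} {α : Type*} [TopologicalSpace α]
    (x : (Fin d → ℤ) → α) : Prop :=
  ∀ S ∈ shiftCentralizer x, ∃ h : Fin d → ℤ, S = shiftHomeo x h

/-- `Per(x, Z, σ)`: the positions at which `x` carries the symbol `σ` along the whole coset
of `Z`. -/
def Per {d : ℕ} {α : Type*} (x : (Fin d → ℤ) → α) (Z : AddSubgroup (Fin d → ℤ)) (σ : α) :
    Set (Fin d → ℤ) :=
  {w | ∀ z ∈ Z, x (w + z) = σ}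

/-- The subgroup `n₁ℤ × ⋯ × n_dℤ` of `ℤ^d`. -/
def boxLattice {d : ℕ} (n : Fin d → ℕ) : AddSubgroup (Fin d → ℤ) :=
  AddSubgroup.pi Set.univ fun i => AddSubgroup.zmultiples (n i : ℤ)

/-- `v` is a position in a block of side lengths `n`. -/
def InBox {d : ℕ} (n v : Fin d → ℕ) : Prop := ∀ i, v i < n i

/-- Position `v` of the `t`-block with index `z` (inside `A_{t+1}`), where `n` are the side
lengths of the `t`-blocks. -/
def blockPos {d : ℕ} (n z v : Fin d → ℕ) : Fin d → ℕ := fun i => z i * n i + v i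

/-- The hole-filling block construction. The block `A t` has side lengths `p t`; its entry at a
position `v` in the box is `some σ` if that cell is filled with `σ`, and `none` if it is a hole
(values outside the box are irrelevant). The block `A (t + 1)` consists of
`p (t + 1) i / p t i` copies of `A t` along each dimension `i`, with some holes filled. -/
structure IsBlockConstruction {d : ℕ} {α : Type*} (p : ℕ → Fin d → ℕ)
    (A : ℕ → (Fin d → ℕ) → Option α) : Prop where
  pos : ∀ t i, 0 < p t i
  two_le : ∀ i, 2 ≤ p 0 i
  dvd : ∀ t i, p t i ∣ p (t + 1) i
  copies : ∀ t z v, InBox (fun i => p (t + 1) i / p t i) z → InBox (p t) v →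
    ∀ σ, A t v = some σ → A (t + 1) (blockPos (p t) z v) = some σ

/-- `ω` is the array on `ℤ^d` produced by the blocks `A t`. The copies of `A t` tile `ℤ^d` with
corners at the points `c t + boxLattice (p t)`; the tilings are nested; every filled cell
prescribes `ω` in all copies; every position of `ℤ^d` is eventually filled; and the holes of
`A t` are the cells at which the `t`-blocks of `ω` do not all agree. -/
structure IsLimitArray {d : ℕ} {α : Type*} (p : ℕ → Fin d → ℕ)
    (A : ℕ → (Fin d → ℕ) → Option α) (c : ℕ → Fin d → ℤ) (ω : (Fin d → ℤ) → α) : Prop where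
  nested : ∀ t, c (t + 1) - c t ∈ boxLattice (p t)
  filled : ∀ t v, InBox (p t) v → ∀ σ, A t v = some σ →
    (fun i => c t i + (v i : ℤ)) ∈ Per ω (boxLattice (p t)) σ
  covers : ∀ w : Fin d → ℤ, ∃ t v, InBox (p t) v ∧ (∃ σ, A t v = some σ) ∧
    (w - fun i => c t i + (v i : ℤ)) ∈ boxLattice (p t)
  holes : ∀ t v, InBox (p t) v → A t v = none →
    ∀ σ, (fun i => c t i + (v i : ℤ)) ∉ Per ω (boxLattice (p t)) σ

/-- The `t`-block of `A (t + 1)` with index `z` has no holes. -/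
def IsFilledBlock {d : ℕ} {α : Type*} (p : ℕ → Fin d → ℕ)
    (A : ℕ → (Fin d → ℕ) → Option α) (t : ℕ) (z : Fin d → ℕ) : Prop :=
  ∀ v, InBox (p t) v → ∃ σ, A (t + 1) (blockPos (p t) z v) = some σ

/-- Condition `(*)`: every `t`-block of `A (t + 1)` is `A t` or `A t` with all holes filled, and
the `t`-blocks on the perimeter of `A (t + 1)` have all holes filled. -/
structure ConditionStar {d : ℕ} {α : Type*} (p : ℕ → Fin d → ℕ)
    (A : ℕ → (Fin d → ℕ) → Option α) : Prop where
  block : ∀ t z, InBox (fun i => p (t + 1) i / p t i) z →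
    (∀ v, InBox (p t) v → A (t + 1) (blockPos (p t) z v) = A t v) ∨ IsFilledBlock p A t z
  perimeter : ∀ t z, InBox (fun i => p (t + 1) i / p t i) z →
    (∃ i, z i = 0 ∨ z i + 1 = p (t + 1) i / p t i) → IsFilledBlock p A t z

end ZdToeplitz

namespace ZdToeplitz

/-! By compactness `S` and `S⁻¹` are block codes of some radius `r`, and `S ω` is again built from
the blocks `A t`, with corners `c' t`. A hole of one array lies within `r` of a hole of the other:
if a window contains no hole at level `t`, its content repeats along `boxLattice (p t)`. So the
periodic hole set of `A t` is `r`-close to its translate by `j t = c' t - c t`.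

Condition `(*)` makes this rigid. The perimeter clause separates holes in different tiles, and the
block clause says that a tile keeps all of its holes or none. Hence the set of unfilled tiles is
invariant under the difference of the tile displacements of any two close pairs of holes. Such
differences are at most one tile per coordinate, and a nonzero one could be iterated onto the
perimeter, so the displacement is constant (`displacement_eq`). Extremal holes then place `j t`
within `r` of the lattice (`exists_offset`). As `p t` grows, the small remainders stabilize to one
`k` (`exists_common_offset`), and `S ω = shift (-k) ω`. Density of the orbit gives `S`. -/

theorem mem_boxLattice {d : ℕ} {n : Fin d → ℕ} {z : Fin d → ℤ} :
    z ∈ boxLattice n ↔ ∀ i, (n i : ℤ) ∣ z i := by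
  simp [boxLattice, AddSubgroup.mem_pi, Int.mem_zmultiples_iff]

theorem boxLattice_mono {d : ℕ} {m n : Fin d → ℕ} (h : ∀ i, m i ∣ n i) :
    boxLattice n ≤ boxLattice m := fun _ hz =>
  mem_boxLattice.2 fun i => (Int.natCast_dvd_natCast.2 (h i)).trans (mem_boxLattice.1 hz i)

/-- A nested family `H t` of subsets of `ℤ^d`, each invariant under `boxLattice (p t)`, with the
properties of the sets of holes of blocks satisfying condition `(*)`. -/
structure IsHoleSystem {d : ℕ} (p : ℕ → Fin d → ℕ) (H : ℕ → (Fin d → ℤ) → Prop) : Prop where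
  pos : ∀ t i, 0 < p t i
  dvd : ∀ t i, p t i ∣ p (t + 1) i
  periodic : ∀ t u z, z ∈ boxLattice (p t) → H t u → H t (u + z)
  mono : ∀ t u, H (t + 1) u → H t u
  block : ∀ t u v, (∀ i, u i / (p t i : ℤ) = v i / (p t i : ℤ)) → H (t + 1) u → H t v →
    H (t + 1) v
  margin : ∀ t u, H (t + 1) u → ∀ i, (p t i : ℤ) ≤ u i % (p (t + 1) i : ℤ) ∧
    u i % (p (t + 1) i : ℤ) < p (t + 1) i - p t i

/-- `u` and `w` are within distance `r` of each other after translating `w` by `j`. -/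
def Near {d : ℕ} (r : ℕ) (j u w : Fin d → ℤ) : Prop := ∀ i, |w i + j i - u i| ≤ r

/-! ### Rigidity of nested periodic hole sets. -/

namespace IsHoleSystem

variable {d : ℕ} {p : ℕ → Fin d → ℕ} {H : ℕ → (Fin d → ℤ) → Prop}

theorem boxLattice_antitone (hH : IsHoleSystem p H) :
    Antitone fun t => boxLattice (p t) :=
  antitone_nat_of_succ_le fun t => boxLattice_mono (hH.dvd t)

/-- The two margins around a hole force `p (t + 1) i > 2 * p t i`. Thus any fixed radius is
eventually smaller than the tiles. -/
theorem lt_of_nonempty (hH : IsHoleSystem p H) (hne : ∀ t, ∃ u, H t u) (t : ℕ) (i : Fin d) :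
    t < p t i := by
  induction t with
  | zero => exact hH.pos 0 i
  | succ t ih =>
    obtain ⟨u, hu⟩ := hne (t + 1)
    have := hH.margin t u hu i
    omega

/-- Holes of the same level which are close lie in the same tile. -/
theorem ediv_eq (hH : IsHoleSystem p H) {r : ℕ} {t : ℕ} (i : Fin d) (hr : r < p t i)
    {u v : Fin d → ℤ} (hu : H (t + 1) u) (hv : H (t + 1) v) (h : |u i - v i| ≤ 2 * r) :
    u i / (p (t + 1) i : ℤ) = v i / (p (t + 1) i : ℤ) := by
  have hP : (0 : ℤ) < p (t + 1) i := by exact_mod_cast hH.pos (t + 1) i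
  have h1 := hH.margin t u hu i
  have h2 := hH.margin t v hv i
  have e1 := Int.mul_ediv_add_emod (u i) (p (t + 1) i)
  have e2 := Int.mul_ediv_add_emod (v i) (p (t + 1) i)
  rw [abs_le] at h
  -- In different tiles the two margins would separate the coordinates by more than `2 * p t i`,
  -- hence by more than `2 * r`.
  apply le_antisymm <;> by_contra! hlt <;> nlinarith

/-- The translate of `u` lying in the tile `Z`. -/
theorem exists_translate (hH : IsHoleSystem p H) (t : ℕ) (u Z : Fin d → ℤ) :
    ∃ z ∈ boxLattice (p t), ∀ v : Fin d → ℤ, ∀ i,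
      (v + z) i / (p t i : ℤ) = v i / (p t i : ℤ) + (Z i - u i / (p t i : ℤ)) := by
  refine ⟨fun i => p t i * (Z i - u i / (p t i : ℤ)), mem_boxLattice.2 fun i => dvd_mul_right _ _,
    fun v i => ?_⟩
  have hP : (p t i : ℤ) ≠ 0 := by exact_mod_cast (hH.pos t i).ne'
  simp [Int.add_mul_ediv_left _ _ hP]

section

variable {r t : ℕ} {j : Fin d → ℤ}

/-- The partner of `u` at level `t + 2` is within `2 * r` of `w`, so it shares the tile of `w`. That
tile is therefore unfilled, and `w` survives. -/
theorem succ_of_near (hH : IsHoleSystem p H) (hr : ∀ i, r < p t i)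
    (h : ∀ u, H (t + 2) u → ∃ w, H (t + 2) w ∧ Near r j u w)
    {u w : Fin d → ℤ} (hw : H (t + 1) w) (huw : Near r j u w)
    (hu : H (t + 2) u) : H (t + 2) w := by
  obtain ⟨w', hw', huw'⟩ := h u hu
  refine hH.block _ w' w (fun i => hH.ediv_eq i (hr i) (hH.mono _ _ hw') hw ?_) hw' hw
  have h1 := abs_le.1 (huw i)
  have h2 := abs_le.1 (huw' i)
  rw [abs_le]
  constructor <;> linarith

theorem succ_of_near' (hH : IsHoleSystem p H) (hr : ∀ i, r < p t i)
    (h : ∀ w, H (t + 2) w → ∃ u, H (t + 2) u ∧ Near r j u w)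
    {u w : Fin d → ℤ} (hu : H (t + 1) u) (huw : Near r j u w)
    (hw : H (t + 2) w) : H (t + 2) u := by
  obtain ⟨u', hu', huw'⟩ := h w hw
  refine hH.block _ u' u (fun i => hH.ediv_eq i (hr i) (hH.mono _ _ hu') hu ?_) hu' hu
  have h1 := abs_le.1 (huw i)
  have h2 := abs_le.1 (huw' i)
  rw [abs_le]
  constructor <;> linarith

theorem near_add {u w : Fin d → ℤ} (h : Near r j u w) (z : Fin d → ℤ) :
    Near r j (u + z) (w + z) := fun i => by
  have := h i
  simp only [Pi.add_apply]
  rwa [show w i + z i + j i - (u i + z i) = w i + j i - u i by ring]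

/-- The set of tiles with holes is invariant under differences of tile displacements. -/
theorem exists_tile_add (hH : IsHoleSystem p H) (hr : ∀ i, r < p t i)
    (h : ∀ u, H (t + 2) u → ∃ w, H (t + 2) w ∧ Near r j u w)
    (h' : ∀ w, H (t + 2) w → ∃ u, H (t + 2) u ∧ Near r j u w)
    {u w u' w' : Fin d → ℤ} (hu : H (t + 1) u) (hw : H (t + 1) w) (huw : Near r j u w)
    (hu' : H (t + 1) u') (hw' : H (t + 1) w') (huw' : Near r j u' w')
    {x : Fin d → ℤ} (hx : H (t + 2) x) :
    ∃ y, H (t + 2) y ∧ ∀ i, y i / (p (t + 1) i : ℤ) = x i / (p (t + 1) i : ℤ) +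
      ((u i / (p (t + 1) i : ℤ) - w i / (p (t + 1) i : ℤ)) -
        (u' i / (p (t + 1) i : ℤ) - w' i / (p (t + 1) i : ℤ))) := by
  -- The pair `(u', w')` carries the unfilled tile of `x` to that of `w' + z`; the pair `(u, w)`,
  -- used backwards, carries it on to that of `u + s`.
  obtain ⟨z, hz, hz'⟩ := hH.exists_translate (t + 1) u' fun i => x i / (p (t + 1) i : ℤ)
  have a1 : H (t + 2) (u' + z) := by
    refine hH.block _ x _ (fun i => ?_) hx (hH.periodic _ _ _ hz hu')
    rw [hz']; ring
  have a2 : H (t + 2) (w' + z) :=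
    hH.succ_of_near hr h (hH.periodic _ _ _ hz hw') (near_add huw' z) a1
  obtain ⟨s, hs, hs'⟩ := hH.exists_translate (t + 1) w fun i => (w' + z) i / (p (t + 1) i : ℤ)
  have a3 : H (t + 2) (w + s) := by
    refine hH.block _ (w' + z) _ (fun i => ?_) a2 (hH.periodic _ _ _ hs hw)
    rw [hs']; ring
  refine ⟨u + s, hH.succ_of_near' hr h' (hH.periodic _ _ _ hs hu) (near_add huw s) a3,
    fun i => ?_⟩
  rw [hs', hz']
  ring

/-- Iterating a displacement by one tile in direction `i` leads to the perimeter. -/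
theorem not_tile_add_one (hH : IsHoleSystem p H) (i : Fin d)
    (h : ∀ x, H (t + 1) x → ∃ y, H (t + 1) y ∧ y i / (p t i : ℤ) = x i / (p t i : ℤ) + 1)
    (x : Fin d → ℤ) : ¬ H (t + 1) x := by
  intro hx
  have hP : (0 : ℤ) < p t i := by exact_mod_cast hH.pos t i
  have iter : ∀ n : ℕ, ∃ y, H (t + 1) y ∧ y i / (p t i : ℤ) = x i / (p t i : ℤ) + n := by
    intro n
    induction n with
    | zero => exact ⟨x, hx, by simp⟩
    | succ n ih =>
      obtain ⟨y, hy, e⟩ := ih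
      obtain ⟨y', hy', e'⟩ := h y hy
      exact ⟨y', hy', by rw [e', e]; push_cast; ring⟩
  obtain ⟨q, hq⟩ := hH.dvd t i
  have hq0 : (0 : ℤ) < q := by
    have := hH.pos (t + 1) i
    rw [hq] at this
    exact_mod_cast Nat.pos_of_mul_pos_left this
  -- This number of steps makes the tile index divisible by `q`, so `y` lies in a first tile in
  -- direction `i`, against the margin.
  obtain ⟨y, hy, e⟩ := iter ((-(x i / (p t i : ℤ))) % q).toNat
  rw [Int.toNat_of_nonneg (Int.emod_nonneg _ hq0.ne')] at e
  have hm := (hH.margin t y hy i).1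
  have e1 := Int.mul_ediv_add_emod (-(x i / (p t i : ℤ))) q
  have e2 := Int.mul_ediv_add_emod (y i) (p t i)
  have l1 := Int.emod_lt_of_pos (y i) hP
  have l2 := Int.emod_nonneg (y i) hP.ne'
  have : y i % (p (t + 1) i : ℤ) = y i % (p t i : ℤ) := by
    have : y i = y i % (p t i : ℤ) +
        (p (t + 1) i : ℤ) * (-(-(x i / (p t i : ℤ)) / (q : ℤ))) := by
      rw [hq, Nat.cast_mul]
      linear_combination -e2 + (p t i : ℤ) * e + (p t i : ℤ) * e1
    rw [this, Int.add_mul_emod_self_left, ← this]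
    refine Int.emod_eq_of_lt l2 (l1.trans_le ?_)
    exact_mod_cast Nat.le_of_dvd (hH.pos _ _) (hH.dvd t i)
  omega

/-- All pairs of close holes have the same tile displacement. -/
theorem displacement_eq (hH : IsHoleSystem p H) (hr : ∀ i, r < p t i) (hne : ∃ u, H (t + 2) u)
    (h : ∀ u, H (t + 2) u → ∃ w, H (t + 2) w ∧ Near r j u w)
    (h' : ∀ w, H (t + 2) w → ∃ u, H (t + 2) u ∧ Near r j u w)
    {u w u' w' : Fin d → ℤ} (hu : H (t + 1) u) (hw : H (t + 1) w) (huw : Near r j u w)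
    (hu' : H (t + 1) u') (hw' : H (t + 1) w') (huw' : Near r j u' w') (i : Fin d) :
    u i / (p (t + 1) i : ℤ) - w i / (p (t + 1) i : ℤ) =
      u' i / (p (t + 1) i : ℤ) - w' i / (p (t + 1) i : ℤ) := by
  have key : ∀ {u w u' w' : Fin d → ℤ}, H (t + 1) u → H (t + 1) w → Near r j u w →
      H (t + 1) u' → H (t + 1) w' → Near r j u' w' →
      u i / (p (t + 1) i : ℤ) - w i / (p (t + 1) i : ℤ) ≤
      u' i / (p (t + 1) i : ℤ) - w' i / (p (t + 1) i : ℤ) := by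
    intro u w u' w' hu hw huw hu' hw' huw'
    by_contra! hlt
    obtain ⟨x, hx⟩ := hne
    refine hH.not_tile_add_one i (fun x hx => ?_) x hx
    obtain ⟨y, hy, e⟩ := hH.exists_tile_add hr h h' hu hw huw hu' hw' huw' hx
    refine ⟨y, hy, ?_⟩
    rw [e i]
    congr 1
    have hri := hr i
    have m1 := hH.margin t u hu i
    have m2 := hH.margin t w hw i
    have m3 := hH.margin t u' hu' i
    have m4 := hH.margin t w' hw' i
    have e1 := Int.mul_ediv_add_emod (u i) (p (t + 1) i)
    have e2 := Int.mul_ediv_add_emod (w i) (p (t + 1) i)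
    have e3 := Int.mul_ediv_add_emod (u' i) (p (t + 1) i)
    have e4 := Int.mul_ediv_add_emod (w' i) (p (t + 1) i)
    have n1 := abs_le.1 (huw i)
    have n2 := abs_le.1 (huw' i)
    have hP : (0 : ℤ) < p (t + 1) i := by exact_mod_cast hH.pos (t + 1) i
    -- Both differences `u i - w i` and `u' i - w' i` are within `r` of `j i`; with the margins,
    -- displacements differing by 2 or more are impossible.
    refine le_antisymm ?_ (by omega)
    by_contra! h2
    nlinarith
  exact le_antisymm (key hu hw huw hu' hw' huw') (key hu' hw' huw' hu hw huw)

/-- Among the holes of level `t` there is one whose `i`-th coordinate in its tile is maximal. -/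
theorem exists_max (hH : IsHoleSystem p H) (t : ℕ) (i : Fin d) (hne : ∃ u, H t u) :
    ∃ u, H t u ∧ ∀ v, H t v → v i % (p t i : ℤ) ≤ u i % (p t i : ℤ) := by
  have hP : (0 : ℤ) < p t i := by exact_mod_cast hH.pos t i
  obtain ⟨m, ⟨u, hu, rfl⟩, hm⟩ := Int.exists_greatest_of_bdd
    (P := fun m => ∃ u, H t u ∧ u i % (p t i : ℤ) = m)
    ⟨p t i, by rintro _ ⟨u, _, rfl⟩; exact (Int.emod_lt_of_pos _ hP).le⟩
    (let ⟨u, hu⟩ := hne; ⟨_, u, hu, rfl⟩)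
  exact ⟨u, hu, fun v hv => hm _ ⟨v, hv, rfl⟩⟩

/-- If the hole sets of the levels `t + 1` and `t + 2` are close to their translates by `j`, then
`j` is close to the lattice of the level `t + 1`. -/
theorem exists_offset (hH : IsHoleSystem p H) (hr : ∀ i, r < p t i) (hne : ∃ u, H (t + 2) u)
    (h1 : ∀ u, H (t + 1) u → ∃ w, H (t + 1) w ∧ Near r j u w)
    (h1' : ∀ w, H (t + 1) w → ∃ u, H (t + 1) u ∧ Near r j u w)
    (h : ∀ u, H (t + 2) u → ∃ w, H (t + 2) w ∧ Near r j u w)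
    (h' : ∀ w, H (t + 2) w → ∃ u, H (t + 2) u ∧ Near r j u w) :
    ∃ k : Fin d → ℤ, (∀ i, |k i| ≤ r) ∧ j - k ∈ boxLattice (p (t + 1)) := by
  obtain ⟨x, hx⟩ := hne
  have hx1 := hH.mono _ _ hx
  obtain ⟨y, hy, hxy⟩ := h1 x hx1
  refine ⟨fun i => j i - p (t + 1) i * (x i / (p (t + 1) i : ℤ) - y i / (p (t + 1) i : ℤ)),
    fun i => ?_, mem_boxLattice.2 fun i => by simp⟩
  -- No hole has a larger residue than `m`: its partner `w` bounds `k i` below by `-r`, and its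
  -- partner `u` bounds it above by `r`.
  obtain ⟨m, hm, hmax⟩ := hH.exists_max (t + 1) i ⟨x, hx1⟩
  obtain ⟨w, hw, hmw⟩ := h1 m hm
  obtain ⟨u, hu, hum⟩ := h1' m hm
  have d1 := hH.displacement_eq hr ⟨x, hx⟩ h h' hx1 hy hxy hm hw hmw i
  have d2 := hH.displacement_eq hr ⟨x, hx⟩ h h' hx1 hy hxy hu hm hum i
  have l1 := hmax w hw
  have l2 := hmax u hu
  have e1 := Int.mul_ediv_add_emod (m i) (p (t + 1) i)
  have e2 := Int.mul_ediv_add_emod (w i) (p (t + 1) i)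
  have e3 := Int.mul_ediv_add_emod (u i) (p (t + 1) i)
  have n1 := abs_le.1 (hmw i)
  have n2 := abs_le.1 (hum i)
  rw [abs_le]
  beta_reduce
  constructor
  · rw [d1, mul_sub]; linarith
  · rw [d2, mul_sub]; linarith

end

theorem exists_common_offset (hH : IsHoleSystem p H) (hne : ∀ t, ∃ u, H t u) {r : ℕ}
    {j : ℕ → Fin d → ℤ} (hj : ∀ t, j (t + 1) - j t ∈ boxLattice (p t))
    (h : ∀ t u, H t u → ∃ w, H t w ∧ Near r (j t) u w)
    (h' : ∀ t w, H t w → ∃ u, H t u ∧ Near r (j t) u w) :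
    ∃ k : Fin d → ℤ, ∀ t, j t - k ∈ boxLattice (p t) := by
  have step : ∀ t, r ≤ t → ∃ k : Fin d → ℤ, (∀ i, |k i| ≤ r) ∧
      j (t + 1) - k ∈ boxLattice (p (t + 1)) := by
    intro t ht
    have hz : j (t + 2) - j (t + 1) ∈ boxLattice (p (t + 1)) := hj (t + 1)
    have g : ∀ u, H (t + 1) u → ∃ w, H (t + 1) w ∧ Near r (j (t + 2)) u w := fun u hu => by
      obtain ⟨w, hw, hn⟩ := h _ u hu
      refine ⟨w + -(j (t + 2) - j (t + 1)), hH.periodic _ _ _ (neg_mem hz) hw, fun i => ?_⟩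
      have := hn i
      simp only [Pi.add_apply, Pi.neg_apply, Pi.sub_apply]
      rwa [show w i + -(j (t + 2) i - j (t + 1) i) + j (t + 2) i - u i
        = w i + j (t + 1) i - u i by ring]
    have g' : ∀ w, H (t + 1) w → ∃ u, H (t + 1) u ∧ Near r (j (t + 2)) u w := fun w hw => by
      obtain ⟨u, hu, hn⟩ := h' _ w hw
      refine ⟨u + (j (t + 2) - j (t + 1)), hH.periodic _ _ _ hz hu, fun i => ?_⟩
      have := hn i
      simp only [Pi.add_apply, Pi.sub_apply]
      rwa [show w i + j (t + 2) i - (u i + (j (t + 2) i - j (t + 1) i))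
        = w i + j (t + 1) i - u i by ring]
    obtain ⟨k, hk, hk'⟩ := hH.exists_offset
      (fun i => ht.trans_lt (hH.lt_of_nonempty hne t i)) (hne _) g g' (h _) (h' _)
    refine ⟨k, hk, ?_⟩
    rw [show j (t + 1) - k = j (t + 2) - k - (j (t + 2) - j (t + 1)) by abel]
    exact sub_mem hk' hz
  have anti : ∀ {s t}, s ≤ t → boxLattice (p t) ≤ boxLattice (p s) :=
    fun hst => hH.boxLattice_antitone hst
  -- From here on the tiles are longer than `2 * r`, so congruent offsets bounded by `r` coincide.
  obtain ⟨k, hk, hk'⟩ := step (2 * r) (by omega)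
  have large : ∀ n, j (2 * r + n + 1) - k ∈ boxLattice (p (2 * r + n + 1)) := by
    intro n
    induction n with
    | zero => exact hk'
    | succ n ih =>
      obtain ⟨l, hl, hl'⟩ := step (2 * r + (n + 1)) (by omega)
      have hkl : l = k := by
        have hm : k - l ∈ boxLattice (p (2 * r + n + 1)) := by
          rw [show k - l = j (2 * r + n + 1 + 1) - l - (j (2 * r + n + 1 + 1) - j (2 * r + n + 1)) -
            (j (2 * r + n + 1) - k) by abel]
          exact sub_mem (sub_mem (anti (Nat.le_succ _) hl') (hj (2 * r + n + 1))) ih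
        funext i
        have hd := mem_boxLattice.1 hm i
        have hlt := hH.lt_of_nonempty hne (2 * r + n + 1) i
        have := Int.eq_zero_of_abs_lt_dvd hd (by
          have h1 := abs_le.1 (hk i)
          have h2 := abs_le.1 (hl i)
          rw [Pi.sub_apply, abs_lt]
          constructor <;> omega)
        simp only [Pi.sub_apply] at this
        omega
      rw [← hkl]
      exact hl'
  refine ⟨k, fun t => ?_⟩
  have hjt : ∀ n, j (t + n) - j t ∈ boxLattice (p t) := by
    intro n
    induction n with
    | zero => simp
    | succ n ih =>
      convert add_mem (anti (Nat.le_add_right t n) (hj (t + n))) ih using 1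
      simp only [← add_assoc]
      abel
  have h1 := hjt (2 * r + 1)
  have h2 := anti (show t ≤ 2 * r + t + 1 by omega) (large t)
  rw [show t + (2 * r + 1) = 2 * r + t + 1 by omega] at h1
  convert sub_mem h2 h1 using 1
  abel

end IsHoleSystem

end ZdToeplitz

namespace ZdToeplitz

/-! ### Holes of the blocks, and frames of arrays. -/

section Blocks

variable {d : ℕ} {α : Type*} {p : ℕ → Fin d → ℕ} {A : ℕ → (Fin d → ℕ) → Option α}

/-- The `boxLattice (p t)`-periodic extension of the block `A t` to `ℤ^d`. -/
def cell (p : ℕ → Fin d → ℕ) (A : ℕ → (Fin d → ℕ) → Option α) (t : ℕ) (u : Fin d → ℤ) :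
    Option α :=
  A t fun i => (u i % (p t i : ℤ)).toNat

theorem cell_add {t : ℕ} {u z : Fin d → ℤ} (hz : z ∈ boxLattice (p t)) :
    cell p A t (u + z) = cell p A t u := by
  unfold cell
  congr 1
  funext i
  obtain ⟨k, hk⟩ := mem_boxLattice.1 hz i
  simp [hk]

theorem cell_congr {t : ℕ} {u v : Fin d → ℤ} (h : u - v ∈ boxLattice (p t)) :
    cell p A t u = cell p A t v := by
  rw [← cell_add (u := v) h, add_sub_cancel]

theorem cell_natCast {t : ℕ} {v : Fin d → ℕ} (hv : InBox (p t) v) :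
    cell p A t (fun i => (v i : ℤ)) = A t v := by
  unfold cell
  congr 1
  funext i
  rw [Int.emod_eq_of_lt (by positivity) (Int.ofNat_lt.2 (hv i))]
  simp

theorem inBox_emod (hA : IsBlockConstruction p A) (t : ℕ) (u : Fin d → ℤ) :
    InBox (p t) fun i => (u i % (p t i : ℤ)).toNat := fun i => by
  have hP : (0 : ℤ) < p t i := by exact_mod_cast hA.pos t i
  have := Int.emod_lt_of_pos (u i) hP
  have := Int.emod_nonneg (u i) hP.ne'
  simp only
  omega

theorem emod_mul_eq {P q : ℤ} (hP : 0 < P) (hq : 0 < q) (u : ℤ) :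
    u % (P * q) = u / P % q * P + u % P := by
  have e1 := Int.mul_ediv_add_emod u P
  have e2 := Int.mul_ediv_add_emod (u / P) q
  have l1 := Int.emod_lt_of_pos u hP
  have l2 := Int.emod_nonneg u hP.ne'
  have l3 := Int.emod_lt_of_pos (u / P) hq
  have l4 := Int.emod_nonneg (u / P) hq.ne'
  have : u = (u / P % q * P + u % P) + P * q * (u / P / q) := by
    linear_combination -e1 - P * e2
  conv_lhs => rw [this]
  rw [Int.add_mul_emod_self_left]
  exact Int.emod_eq_of_lt (by positivity) (by nlinarith)

/-- The index, in its `(t + 1)`-tile, of the `t`-tile containing `u`. -/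
def tileIndex (p : ℕ → Fin d → ℕ) (t : ℕ) (u : Fin d → ℤ) : Fin d → ℕ :=
  fun i => (u i / (p t i : ℤ) % ((p (t + 1) i / p t i : ℕ) : ℤ)).toNat

theorem quotient_pos (hA : IsBlockConstruction p A) (t : ℕ) (i : Fin d) :
    0 < p (t + 1) i / p t i :=
  Nat.div_pos (Nat.le_of_dvd (hA.pos _ _) (hA.dvd t i)) (hA.pos t i)

theorem inBox_tileIndex (hA : IsBlockConstruction p A) (t : ℕ) (u : Fin d → ℤ) :
    InBox (fun i => p (t + 1) i / p t i) (tileIndex p t u) := fun i => by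
  have hq : (0 : ℤ) < (p (t + 1) i / p t i : ℕ) := by exact_mod_cast quotient_pos hA t i
  have := Int.emod_lt_of_pos (u i / (p t i : ℤ)) hq
  have := Int.emod_nonneg (u i / (p t i : ℤ)) hq.ne'
  simp only [tileIndex]
  omega

theorem emod_succ_eq (hA : IsBlockConstruction p A) (t : ℕ) (u : Fin d → ℤ) (i : Fin d) :
    u i % (p (t + 1) i : ℤ) = tileIndex p t u i * p t i + u i % (p t i : ℤ) := by
  have hP : (0 : ℤ) < p t i := by exact_mod_cast hA.pos t i
  have hq : (0 : ℤ) < (p (t + 1) i / p t i : ℕ) := by exact_mod_cast quotient_pos hA t i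
  have e : (p (t + 1) i : ℤ) = p t i * (p (t + 1) i / p t i : ℕ) := by
    exact_mod_cast (Nat.mul_div_cancel' (hA.dvd t i)).symm
  rw [tileIndex, Int.toNat_of_nonneg (Int.emod_nonneg _ hq.ne'), e, emod_mul_eq hP hq]

theorem cell_succ (hA : IsBlockConstruction p A) (t : ℕ) (u : Fin d → ℤ) :
    cell p A (t + 1) u =
      A (t + 1) (blockPos (p t) (tileIndex p t u) fun i => (u i % (p t i : ℤ)).toNat) := by
  unfold cell blockPos
  congr 1
  funext i
  have hP : (0 : ℤ) < p t i := by exact_mod_cast hA.pos t i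
  have := Int.emod_nonneg (u i) hP.ne'
  rw [emod_succ_eq hA, Int.toNat_add (by positivity) this]
  norm_cast

theorem isHoleSystem (hA : IsBlockConstruction p A) (hstar : ConditionStar p A) :
    IsHoleSystem p fun t u => cell p A t u = none where
  pos := hA.pos
  dvd := hA.dvd
  periodic t u z hz h := (cell_add hz).trans h
  mono t u h := by
    by_contra hne
    obtain ⟨σ, hσ⟩ := Option.ne_none_iff_exists'.1 hne
    rw [cell_succ hA, hA.copies t _ _ (inBox_tileIndex hA t u) (inBox_emod hA t u) σ hσ] at h
    cases h
  block t u v huv hu hv := by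
    have hidx : tileIndex p t u = tileIndex p t v := by
      funext i
      simp only [tileIndex, huv i]
    rcases hstar.block t _ (inBox_tileIndex hA t u) with h | h
    · rw [cell_succ hA, ← hidx, h _ (inBox_emod hA t v)]
      exact hv
    · obtain ⟨σ, hσ⟩ := h _ (inBox_emod hA t u)
      rw [cell_succ hA, hσ] at hu
      cases hu
  margin t u hu i := by
    have hnot : ¬ ∃ i, tileIndex p t u i = 0 ∨
        tileIndex p t u i + 1 = p (t + 1) i / p t i := fun hper => by
      obtain ⟨σ, hσ⟩ := hstar.perimeter t _ (inBox_tileIndex hA t u) hper _ (inBox_emod hA t u)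
      rw [cell_succ hA, hσ] at hu
      cases hu
    push Not at hnot
    obtain ⟨h0, h1⟩ := hnot i
    have h2 := inBox_tileIndex hA t u i
    have hP : (0 : ℤ) < p t i := by exact_mod_cast hA.pos t i
    have l1 := Int.emod_lt_of_pos (u i) hP
    have l2 := Int.emod_nonneg (u i) hP.ne'
    have e : (p (t + 1) i : ℤ) = p t i * (p (t + 1) i / p t i : ℕ) := by
      exact_mod_cast (Nat.mul_div_cancel' (hA.dvd t i)).symm
    rw [emod_succ_eq hA, e]
    have b0 : (1 : ℤ) ≤ tileIndex p t u i := by omega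
    have b1 : (tileIndex p t u i : ℤ) + 2 ≤ (p (t + 1) i / p t i : ℕ) := by
      simp only at h2
      omega
    constructor <;> nlinarith

/-- The array `x` is built from the blocks `A t` placed with corners at `c t`, except that some
positions may never be filled. -/
structure IsFrame (p : ℕ → Fin d → ℕ) (A : ℕ → (Fin d → ℕ) → Option α)
    (c : ℕ → Fin d → ℤ) (x : (Fin d → ℤ) → α) : Prop where
  nested : ∀ t, c (t + 1) - c t ∈ boxLattice (p t)
  filled : ∀ t w σ, cell p A t (w - c t) = some σ → x w = σ
  holes : ∀ t w, cell p A t (w - c t) = none → ∃ z ∈ boxLattice (p t), x (w + z) ≠ x w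

variable {c : ℕ → Fin d → ℤ} {ω : (Fin d → ℤ) → α}

theorem sub_emod_mem (p : ℕ → Fin d → ℕ) (hpos : ∀ t i, 0 < p t i) (t : ℕ) (u : Fin d → ℤ) :
    (u - fun i => ((u i % (p t i : ℤ)).toNat : ℤ)) ∈ boxLattice (p t) := by
  refine mem_boxLattice.2 fun i => ?_
  have hP : (0 : ℤ) < p t i := by exact_mod_cast hpos t i
  rw [Pi.sub_apply, Int.toNat_of_nonneg (Int.emod_nonneg _ hP.ne')]
  exact Int.dvd_self_sub_emod

theorem IsLimitArray.isFrame (hA : IsBlockConstruction p A) (hω : IsLimitArray p A c ω) :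
    IsFrame p A c ω where
  nested := hω.nested
  filled t w σ h := by
    have := hω.filled t _ (inBox_emod hA t (w - c t)) σ h _ (sub_emod_mem p hA.pos t (w - c t))
    rw [← this]
    congr 1
    funext i
    simp
  holes t w h := by
    by_contra! hcon
    refine hω.holes t _ (inBox_emod hA t (w - c t)) h (ω w) fun z hz => ?_
    rw [← hcon _ (sub_mem hz (sub_emod_mem p hA.pos t (w - c t)))]
    congr 1
    funext i
    simp
    ring

theorem IsLimitArray.exists_cell (hω : IsLimitArray p A c ω) (w : Fin d → ℤ) :
    ∃ t, cell p A t (w - c t) = some (ω w) := by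
  obtain ⟨t, v, hv, ⟨σ, hσ⟩, hw⟩ := hω.covers w
  refine ⟨t, ?_⟩
  have h1 := hω.filled t v hv σ hσ _ hw
  rw [add_sub_cancel] at h1
  rw [h1, ← hσ, ← cell_natCast (A := A) hv]
  refine cell_congr ?_
  convert hw using 1
  funext i
  simp
  ring

/-- If the frames of `ω` and `y` differ by a translation, then `y` is a translate of `ω`. -/
theorem IsFrame.eq_shift_of_offset (hfr : IsFrame p A c ω) {y : (Fin d → ℤ) → α}
    {c' : ℕ → Fin d → ℤ} (hy : IsFrame p A c' y) {k : Fin d → ℤ}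
    (hk : ∀ w, ∃ t, cell p A t (w - c t) ≠ none ∧ c' t - c t - k ∈ boxLattice (p t)) : y = shift (-k) ω := by
  funext w
  obtain ⟨t, hne, hkt⟩ := hk (w + -k)
  obtain ⟨σ, hσ⟩ := Option.ne_none_iff_exists'.1 hne
  rw [shift, hfr.filled t _ σ hσ]
  refine hy.filled t w σ ?_
  rw [← hσ]
  refine cell_congr ?_
  convert neg_mem hkt using 1
  abel

end Blocks

theorem apply_shift_of_mem_centralizer {d : ℕ} {α : Type*} [TopologicalSpace α]
    {ω : (Fin d → ℤ) → α} {S : orbitClosure ω ≃ₜ orbitClosure ω}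
    (hS : S ∈ shiftCentralizer ω) (g : Fin d → ℤ) (x : orbitClosure ω) :
    (S (shiftHomeo ω g x)).1 = shift g (S x).1 := by
  have := Subgroup.mem_centralizer_iff.1 hS _ ⟨g, rfl⟩
  have h2 := congrArg (fun f : orbitClosure ω ≃ₜ orbitClosure ω => (f x).1) this
  exact h2.symm

/-- Every hole of the frame of `S x` is close to a hole of the frame of `x`. -/
theorem exists_hole_near {d : ℕ} {α : Type*} [TopologicalSpace α] {p : ℕ → Fin d → ℕ}
    {A : ℕ → (Fin d → ℕ) → Option α} {ω : (Fin d → ℤ) → α} {S : orbitClosure ω ≃ₜ orbitClosure ω}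
    (hS : S ∈ shiftCentralizer ω) {r : ℕ} (hr : ∀ a b : orbitClosure ω,
      (∀ v : Fin d → ℤ, (∀ i, |v i| ≤ r) → a.1 v = b.1 v) → (S a).1 0 = (S b).1 0)
    {x : orbitClosure ω} {c c' : ℕ → Fin d → ℤ} (hx : IsFrame p A c x.1)
    (hy : IsFrame p A c' (S x).1) {t : ℕ} {u : Fin d → ℤ} (hu : cell p A t u = none) :
    ∃ w, cell p A t w = none ∧ ∀ i, |w i + c t i - (u i + c' t i)| ≤ r := by
  -- Otherwise the window around `u + c' t` meets no hole of `x`, so it and its translate by `z`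
  -- agree, and `S x` cannot differ there.
  by_contra! hcon
  obtain ⟨z, hz, hne⟩ := hy.holes t (u + c' t) (by rwa [add_sub_cancel_right])
  have h0 : ∀ g, (S x).1 g = (S (shiftHomeo ω g x)).1 0 := fun g => by
    rw [apply_shift_of_mem_centralizer hS]
    simp [shift]
  refine hne ?_
  rw [h0, h0]
  refine hr _ _ fun v hv => ?_
  change x.1 (v + (u + c' t + z)) = x.1 (v + (u + c' t))
  have hsome : cell p A t (v + (u + c' t) - c t) ≠ none := fun hnone => by
    obtain ⟨i, hi⟩ := hcon _ hnone
    refine absurd (hv i) (not_le.2 ?_)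
    convert hi using 2
    simp
  obtain ⟨σ, hσ⟩ := Option.ne_none_iff_exists'.1 hsome
  rw [hx.filled t _ σ hσ]
  refine hx.filled t _ σ ?_
  rw [← hσ, ← cell_add (u := v + (u + c' t) - c t) hz]
  congr 1
  abel

/-! ### Frames in the orbit closure, block codes and density. -/

section Orbit

variable {d : ℕ} {α : Type*} [TopologicalSpace α] [DiscreteTopology α]
  {p : ℕ → Fin d → ℕ} {A : ℕ → (Fin d → ℕ) → Option α}
  {c : ℕ → Fin d → ℤ} {ω : (Fin d → ℤ) → α}

/-- An ultrafilter on `ℤ^d` is eventually in one coset of a lattice. -/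
theorem exists_eventually_sub_mem (F : Ultrafilter (Fin d → ℤ)) {n : Fin d → ℕ}
    (hn : ∀ i, 0 < n i) : ∃ k, ∀ᶠ g in (F : Filter (Fin d → ℤ)), g - k ∈ boxLattice n := by
  have : ∀ i, NeZero (n i) := fun i => ⟨(hn i).ne'⟩
  obtain ⟨a, ha⟩ := (F.map fun g i => (g i : ZMod (n i))).eq_pure_of_finite
  have hev : ∀ᶠ g in (F : Filter (Fin d → ℤ)), (fun i => (g i : ZMod (n i))) = a := by
    have : {a} ∈ F.map fun g i => (g i : ZMod (n i)) := by rw [ha]; rfl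
    exact this
  obtain ⟨k, hk⟩ := hev.exists
  refine ⟨k, hev.mono fun g hg => mem_boxLattice.2 fun i => ?_⟩
  have := (congrFun hk i).trans (congrFun hg i).symm
  exact (ZMod.intCast_eq_intCast_iff_dvd_sub _ _ _).1 this

/-- Every array in the orbit closure has a frame. -/
theorem exists_isFrame (hA : IsBlockConstruction p A) (hω : IsLimitArray p A c ω)
    {y : (Fin d → ℤ) → α} (hy : y ∈ orbitClosure ω) : ∃ c', IsFrame p A c' y := by
  have hfr := hω.isFrame hA
  have hne : (Filter.comap (fun g => shift g ω) (nhds y)).NeBot :=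
    Filter.comap_neBot_iff_frequently.2 (by
      rw [orbitClosure, mem_closure_iff_frequently] at hy
      exact hy)
  let F := Ultrafilter.of (Filter.comap (fun g => shift g ω) (nhds y))
  have hF : Filter.Tendsto (fun g => shift g ω) F (nhds y) :=
    Filter.tendsto_iff_comap.2 (Ultrafilter.of_le _)
  have hev : ∀ w, ∀ᶠ g in (F : Filter (Fin d → ℤ)), ω (w + g) = y w := fun w => by
    have := (tendsto_pi_nhds.1 hF) w
    rw [nhds_discrete, Filter.tendsto_pure] at this
    exact this
  choose k hk using fun t => exists_eventually_sub_mem F (hA.pos t)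
  have nest : ∀ t, (c (t + 1) - k (t + 1)) - (c t - k t) ∈ boxLattice (p t) := fun t => by
    obtain ⟨g, h1, h2⟩ := ((hk t).and (hk (t + 1))).exists
    convert add_mem (hω.nested t) (sub_mem (boxLattice_mono (hA.dvd t) h2) h1) using 1
    abel
  have fill : ∀ t w σ, cell p A t (w - (c t - k t)) = some σ → y w = σ := fun t w σ h => by
    obtain ⟨g, h1, h2⟩ := ((hk t).and (hev w)).exists
    rw [← h2]
    refine hfr.filled t _ σ ?_
    rw [← h]
    refine cell_congr ?_
    convert h1 using 1
    abel
  have sub_mem_lat : ∀ {s t}, s ≤ t → k t - k s ∈ boxLattice (p s) := fun {s t} hst => by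
    obtain ⟨g, h1, h2⟩ := ((hk s).and (hk t)).exists
    have anti : Antitone fun t => boxLattice (p t) :=
      antitone_nat_of_succ_le fun t => boxLattice_mono (hA.dvd t)
    convert sub_mem h1 (anti hst h2) using 1
    abel
  refine ⟨fun t => c t - k t, nest, fill, fun t w h => ?_⟩
  have hw : ∀ z ∈ boxLattice (p t), cell p A t (w + k t + z - c t) = none := fun z hz => by
    rw [← h]
    refine cell_congr ?_
    convert hz using 1
    abel
  -- The values of `ω` witnessing a hole must recur in `y`: each is prescribed by a filled cell at
  -- some level `s`, and `y` has that cell too. Here `s ≥ t`, since a cell filled earlier would be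
  -- constant along `boxLattice (p t)`.
  have lift : ∀ z ∈ boxLattice (p t), ∃ z' ∈ boxLattice (p t),
      y (w + z') = ω (w + k t + z) := fun z hz => by
    obtain ⟨s, hs⟩ := hω.exists_cell (w + k t + z)
    have hts : t ≤ s := by
      by_contra! hlt
      have anti : Antitone fun t => boxLattice (p t) :=
        antitone_nat_of_succ_le fun t => boxLattice_mono (hA.dvd t)
      obtain ⟨z', hz', hne⟩ := hfr.holes t _ (hw z hz)
      refine hne (hfr.filled s _ _ ?_)
      rw [← hs, add_sub_right_comm, cell_add (anti hlt.le hz')]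
    refine ⟨z - (k s - k t), sub_mem hz (sub_mem_lat hts), fill s _ _ ?_⟩
    rw [← hs]
    congr 1
    abel
  by_contra! hcon
  obtain ⟨z, hz, hne⟩ := hfr.holes t (w + k t + 0) (hw 0 (zero_mem _))
  obtain ⟨z1, hz1, e1⟩ := lift z hz
  obtain ⟨z0, hz0, e0⟩ := lift 0 (zero_mem _)
  refine hne ?_
  rw [add_zero] at e0 ⊢
  rw [← e1, ← e0, hcon _ hz1, hcon _ hz0]

instance [Finite α] (x : (Fin d → ℤ) → α) : CompactSpace (orbitClosure x) :=
  isCompact_iff_compactSpace.1 isClosed_closure.isCompact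

/-- A continuous function from an orbit closure to a discrete space depends only on a finite
window. -/
theorem exists_window [Finite α] (x : (Fin d → ℤ) → α) {f : orbitClosure x → α}
    (hf : Continuous f) : ∃ r : ℕ, ∀ a b : orbitClosure x,
      (∀ v : Fin d → ℤ, (∀ i, |v i| ≤ r) → a.1 v = b.1 v) → f a = f b := by
  by_contra! hcon
  -- Pairs agreeing on the window of radius `r` but separated by `f`. A pair in every `K r` would be
  -- equal yet separated.
  let K : ℕ → Set (orbitClosure x × orbitClosure x) := fun r =>
    (⋂ (v : Fin d → ℤ) (_ : ∀ i, |v i| ≤ r), {q | q.1.1 v = q.2.1 v}) ∩ {q | f q.1 ≠ f q.2}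
  have hcl : ∀ r, IsClosed (K r) := fun r => by
    refine IsClosed.inter (isClosed_biInter fun v _ => isClosed_eq ?_ ?_) ?_
    · exact (continuous_apply v).comp (continuous_subtype_val.comp continuous_fst)
    · exact (continuous_apply v).comp (continuous_subtype_val.comp continuous_snd)
    · exact (isClosed_discrete {q : α × α | q.1 ≠ q.2}).preimage
        ((hf.comp continuous_fst).prodMk (hf.comp continuous_snd))
  obtain ⟨⟨a, b⟩, hab⟩ := IsCompact.nonempty_iInter_of_sequence_nonempty_isCompact_isClosed K
    (fun r q hq => ⟨Set.mem_iInter₂.2 fun v hv => Set.mem_iInter₂.1 hq.1 v fun i =>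
      (hv i).trans (by push_cast; linarith), hq.2⟩)
    (fun r => by
      obtain ⟨a, b, h, hne⟩ := hcon r
      exact ⟨(a, b), Set.mem_iInter₂.2 h, hne⟩)
    (hcl 0).isCompact hcl
  rw [Set.mem_iInter] at hab
  refine (hab 0).2 (congrArg f (Subtype.ext (funext fun v => ?_)))
  refine Set.mem_iInter₂.1 (hab (∑ i, (v i).natAbs)).1 v fun i => ?_
  have := Finset.single_le_sum (f := fun i => (v i).natAbs) (fun _ _ => Nat.zero_le _)
    (Finset.mem_univ i)
  rw [Int.abs_eq_natAbs]
  exact_mod_cast this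

/-- An element of the centralizer is determined by the image of `ω`. -/
theorem eq_shiftHomeo_of_apply {S : orbitClosure ω ≃ₜ orbitClosure ω}
    (hS : S ∈ shiftCentralizer ω) {h : Fin d → ℤ} {o : orbitClosure ω} (ho : o.1 = ω)
    (hSo : (S o).1 = shift h ω) : S = shiftHomeo ω h := by
  have hdense : DenseRange fun g => shiftHomeo ω g o := by
    intro x
    rw [closure_subtype, ← Set.range_comp]
    have := x.2
    simp only [orbitClosure] at this
    convert this using 3
    funext g
    simp [shiftHomeo, ho]
  refine DFunLike.coe_injective (hdense.equalizer S.continuous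
    (shiftHomeo ω h).continuous (funext fun g => Subtype.ext ?_))
  change (S (shiftHomeo ω g o)).1 = shift h (shift g o.1)
  rw [apply_shift_of_mem_centralizer hS, hSo, ho, shift_shift, shift_shift, add_comm]

end Orbit

end ZdToeplitz

/-! ### Triviality of the centralizer. -/

theorem mainTheorem1 {d : ℕ} {α : Type*} [Finite α] [TopologicalSpace α] [DiscreteTopology α]
    (p : ℕ → Fin d → ℕ) (A : ℕ → (Fin d → ℕ) → Option α) (c : ℕ → Fin d → ℤ)
    (ω : (Fin d → ℤ) → α)
    (hA : ZdToeplitz.IsBlockConstruction p A)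
    (hω : ZdToeplitz.IsLimitArray p A c ω)
    (hstar : ZdToeplitz.ConditionStar p A) :
    ZdToeplitz.HasTrivialCentralizer ω := by
  intro S hS
  have hfr := hω.isFrame hA
  let o : ZdToeplitz.orbitClosure ω :=
    ⟨ω, subset_closure ⟨0, ZdToeplitz.shift_zero ω⟩⟩
  obtain ⟨c', hc'⟩ := ZdToeplitz.exists_isFrame hA hω (S o).2
  suffices h : ∃ k : Fin d → ℤ, ∀ w, ∃ t, ZdToeplitz.cell p A t (w - c t) ≠ none ∧
      c' t - c t - k ∈ ZdToeplitz.boxLattice (p t) by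
    obtain ⟨k, hk⟩ := h
    exact ⟨-k, ZdToeplitz.eq_shiftHomeo_of_apply hS (o := o) rfl
      (hfr.eq_shift_of_offset hc' hk)⟩
  by_cases hne : ∀ t, ∃ u, ZdToeplitz.cell p A t u = none
  · have hS' : S⁻¹ ∈ ZdToeplitz.shiftCentralizer ω := inv_mem hS
    have cont : ∀ R : ZdToeplitz.orbitClosure ω ≃ₜ ZdToeplitz.orbitClosure ω,
        Continuous fun a => (R a).1 0 := fun R =>
      (continuous_apply 0).comp (continuous_subtype_val.comp R.continuous)
    obtain ⟨r₁, hr₁⟩ := ZdToeplitz.exists_window ω (cont S)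
    obtain ⟨r₂, hr₂⟩ := ZdToeplitz.exists_window ω (cont S⁻¹)
    have hback : S⁻¹ (S o) = o := S.symm_apply_apply o
    obtain ⟨k, hk⟩ := (ZdToeplitz.isHoleSystem hA hstar).exists_common_offset hne
      (r := max r₁ r₂) (j := fun t => c' t - c t)
      (fun t => by
        convert sub_mem (hc'.nested t) (hfr.nested t) using 1
        abel)
      (fun t u hu => by
        obtain ⟨w, hw, hn⟩ := ZdToeplitz.exists_hole_near hS' hr₂ (x := S o) hc'
          (by rw [hback]; exact hfr) hu
        refine ⟨w, hw, fun i => ?_⟩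
        refine (le_of_eq ?_).trans ((hn i).trans (by exact_mod_cast le_max_right r₁ r₂))
        congr 1
        simp only [Pi.sub_apply]
        ring)
      (fun t w hw => by
        obtain ⟨u, hu, hn⟩ := ZdToeplitz.exists_hole_near hS hr₁ (x := o) hfr hc' hw
        refine ⟨u, hu, fun i => ?_⟩
        rw [abs_sub_comm]
        refine (le_of_eq ?_).trans ((hn i).trans (by exact_mod_cast le_max_left r₁ r₂))
        congr 1
        simp only [Pi.sub_apply]
        ring)
    refine ⟨k, fun w => ?_⟩
    obtain ⟨t, ht⟩ := hω.exists_cell w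
    exact ⟨t, by simp [ht], hk t⟩
  -- If some `A t` has no holes, the arrays are periodic and that single level determines the
  -- offset.
  · push Not at hne
    obtain ⟨t, ht⟩ := hne
    exact ⟨c' t - c t, fun w => ⟨t, ht _, by simp⟩⟩
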